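/- Let $M$ be a connected compact complex manifold of dimension $n$ with Kähler form $\omega$, written $\omega = \mathrm{i}\sum_{j,k} g_{jk}\,dz_j\wedge d\bar z_k$ in local holomorphic coordinates, with $(g_{jk})$ hermitian and positive definite. Let $L$ be a holomorphic line bundle on $M$ with a smooth hermitian metric $h$ (antilinear in the first argument) satisfying the quantum condition: the curvature of the unique connection compatible with $h$ and with the holomorphic structure is $-\mathrm{i}\,\omega$, i.e. $\mathrm{i}\,\bar\partial\partial\log\hat h=\omega$, where $\hat h=h(s,s)$ for a local holomorphic frame $s$ of $L$. Assume that $L$ is very ample, i.e. that its global holomorphic sections embed $M$ into projective space. Let $m\ge 0$ be an integer, let $h^{(m)}$ be the metric induced by $h$ on $L^m=L^{\otimes m}$, and equip the space $\Gamma_{hol}(M,L^m)$ of global holomorphic sections of $L^m$ with the scalar product $$\langle\varphi,\psi\rangle=\int_M h^{(m)}(\varphi,\psi)\,\Omega,\qquad \Omega=\tfrac1{n!}\,\omega^{\wedge n}.$$ Then for every $x\in M$ and every nonzero $\alpha$ in the fibre over $x$ of the dual bundle $L^*$ there is a unique $e_\alpha^{(m)}\in\Gamma_{hol}(M,L^m)$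 with $$\langle e_\alpha^{(m)},s\rangle=\alpha^{\otimes m}(s(x))\qquad\text{for all } s\in\Gamma_{hol}(M,L^m),$$ and $\langle e_\alpha^{(m)},e_\alpha^{(m)}\rangle\neq 0$. For $A\in\mathrm{End}(\Gamma_{hol}(M,L^m))$ the covariant Berezin symbol $$\sigma^{(m)}(A)(x)=\frac{\langle e_\alpha^{(m)},A e_\alpha^{(m)}\rangle}{\langle e_\alpha^{(m)},e_\alpha^{(m)}\rangle}\qquad (0\neq\alpha\in L^*_x)$$ does not depend on the choice of $\alpha$ and is a smooth function of $x\in M$. The covariant symbol map $$\sigma^{(m)}:\mathrm{End}(\Gamma_{hol}(M,L^m))\to C^\infty(M),\qquad A\mapsto\sigma^{(m)}(A),$$ is injective. -/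

import Mathlib

open Bundle MeasureTheory
open scoped Manifold ContDiff TensorProduct

noncomputable section

namespace BerezinToeplitz

/-! ### Kähler forms and the Liouville measure

A complex manifold of dimension `n` is a charted space over `Fin n → ℂ` with holomorphic
transition maps. Its underlying real manifold has the same charts, and the tangent space at `x`
is the model space `Fin n → ℂ` (read in the preferred chart at `x`), so that the almost complex
structure `J` is multiplication by `i`. -/

section Kahler

variable {n : ℕ} {M : Type*} [TopologicalSpace M] [ChartedSpace (Fin n → ℂ) M]

/-- The almost complex structure `J` on the real tangent space at `x`. -/
def complexStructure (x : M) (v : TangentSpace 𝓘(ℝ, Fin n → ℂ) x) :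
    TangentSpace 𝓘(ℝ, Fin n → ℂ) x :=
  (Complex.I • (show Fin n → ℂ from v) : Fin n → ℂ)

/-- The expression, in a chart `φ`, of a field `w` of alternating bilinear forms on `M`: the
pull-back of `w` under `φ⁻¹`. -/
def formInChart
    (w : ∀ x : M, TangentSpace 𝓘(ℝ, Fin n → ℂ) x [⋀^Fin 2]→L[ℝ] ℝ)
    (φ : OpenPartialHomeomorph M (Fin n → ℂ)) (z : Fin n → ℂ) :
    (Fin n → ℂ) [⋀^Fin 2]→L[ℝ] ℝ :=
  (w (φ.symm z)).compContinuousLinearMap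
    (mfderiv 𝓘(ℝ, Fin n → ℂ) 𝓘(ℝ, Fin n → ℂ) φ.symm z)

variable (n M) in
/-- A Kähler form: a smooth closed real two-form of type `(1,1)` (that is, `J`-invariant) which is
positive (`ω(v, Jv) > 0` for `v ≠ 0`). -/
structure KahlerForm where
  /-- the value of the form at each point -/
  form : ∀ x : M, TangentSpace 𝓘(ℝ, Fin n → ℂ) x [⋀^Fin 2]→L[ℝ] ℝ
  smooth : ∀ φ ∈ atlas (Fin n → ℂ) M, ContDiffOn ℝ ∞ (formInChart form φ) φ.target
  closed : ∀ φ ∈ atlas (Fin n → ℂ) M, ∀ z ∈ φ.target, extDeriv (formInChart form φ) z = 0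
  type_one_one : ∀ (x : M) (v w : TangentSpace 𝓘(ℝ, Fin n → ℂ) x),
    form x ![complexStructure x v, complexStructure x w] = form x ![v, w]
  pos : ∀ (x : M) (v : TangentSpace 𝓘(ℝ, Fin n → ℂ) x), v ≠ 0 →
    0 < form x ![v, complexStructure x v]

namespace KahlerForm

variable (κ : KahlerForm n M)

/-- The hermitian matrix `g` with `ω = i ∑ g_{jk} dz_j ∧ dz̄_k` in the holomorphic coordinates
given by `φ`, that is `g_{jk} = -i ω(∂/∂z_j, ∂/∂z̄_k) = (ω(e_j, i e_k) - i ω(e_j, e_k)) / 2`. -/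
def coeff (φ : OpenPartialHomeomorph M (Fin n → ℂ)) (z : Fin n → ℂ) :
    Matrix (Fin n) (Fin n) ℂ := fun j k =>
  (((formInChart κ.form φ z ![Pi.single j 1, Pi.single k Complex.I] : ℝ) : ℂ)
    - Complex.I * ((formInChart κ.form φ z ![Pi.single j 1, Pi.single k 1] : ℝ) : ℂ)) / 2

/-- The density of the Liouville form `Ω = ω^n / n!` in the chart `φ` with respect to Lebesgue
measure: since `i dz ∧ dz̄ = 2 dx ∧ dy`, one has `ω^n / n! = 2^n det(g) dx_1 dy_1 ⋯ dx_n dy_n`. -/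
def liouvilleDensity (φ : OpenPartialHomeomorph M (Fin n → ℂ)) (z : Fin n → ℂ) : ℝ :=
  2 ^ n * (κ.coeff φ z).det.re

end KahlerForm

variable (n M) in
theorem exists_chart_partition [T2Space M] [CompactSpace M] :
    ∃ ρ : PartitionOfUnity M M Set.univ,
      ρ.IsSubordinate fun p : M => (chartAt (Fin n → ℂ) p).source :=
  PartitionOfUnity.exists_isSubordinate isClosed_univ _
    (fun p => (chartAt (Fin n → ℂ) p).open_source)
    (fun p _ => Set.mem_iUnion.2 ⟨p, mem_chart_source (Fin n → ℂ) p⟩)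

variable (n M) in
/-- A partition of unity subordinate to the domains of the preferred charts. -/
def chartPartition [T2Space M] [CompactSpace M] : PartitionOfUnity M M Set.univ :=
  (exists_chart_partition n M).choose

/-- The measure on `M` defined by the Liouville volume form `Ω = ω^n / n!`, by the usual
prescription for the integral of a top-degree form: `∫ f Ω = ∑_p ∫ (ρ_p f) Ω`, where `ρ` is a
partition of unity subordinate to charts and each summand is computed in its chart. (By the change
of variables formula it does not depend on `ρ` or on the charts.) -/
def KahlerForm.liouville [T2Space M] [CompactSpace M] [MeasurableSpace M]
    (κ : KahlerForm n M) : Measure M :=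
  Measure.sum fun p : M =>
    Measure.map (chartAt (Fin n → ℂ) p).symm
      ((volume.restrict (chartAt (Fin n → ℂ) p).target).withDensity fun z =>
        ENNReal.ofReal (chartPartition n M p ((chartAt (Fin n → ℂ) p).symm z) *
          κ.liouvilleDensity (chartAt (Fin n → ℂ) p) z))

end Kahler

/-! ### Line bundles, their tensor powers, metrics and sections -/

/-- The linear form `α^{⊗m}` on `V^{⊗m}`:
`α^{⊗m}(v_1 ⊗ ⋯ ⊗ v_m) = α(v_1) ⋯ α(v_m)`. -/
def dualPow (m : ℕ) {V : Type*} [AddCommGroup V] [Module ℂ V] (α : V →ₗ[ℂ] ℂ) :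
    (⨂[ℂ]^m V) →ₗ[ℂ] ℂ :=
  PiTensorProduct.lift ((MultilinearMap.mkPiAlgebra ℂ (Fin m) ℂ).compLinearMap fun _ => α)

section LineBundle

variable {n : ℕ} {M : Type*} [TopologicalSpace M] [ChartedSpace (Fin n → ℂ) M]
  {L : M → Type*} [∀ x, AddCommGroup (L x)] [∀ x, Module ℂ (L x)] [∀ x, TopologicalSpace (L x)]
  [TopologicalSpace (TotalSpace ℂ L)] [FiberBundle ℂ L] [VectorBundle ℂ ℂ L]

variable (n L) in
/-- A smooth hermitian metric on the line bundle `L`, antilinear in the first argument. -/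
structure HermitianMetric where
  /-- the sesquilinear form on each fibre -/
  inner : ∀ x : M, L x →ₗ⋆[ℂ] L x →ₗ[ℂ] ℂ
  conj_symm : ∀ (x : M) (u v : L x), star (inner x u v) = inner x v u
  pos : ∀ (x : M) (v : L x), v ≠ 0 → 0 < (inner x v v).re
  smooth : ∀ (e : Trivialization ℂ (TotalSpace.proj : TotalSpace ℂ L → M))
    [MemTrivializationAtlas e],
    ContMDiffOn 𝓘(ℝ, Fin n → ℂ) 𝓘(ℝ, ℂ) ∞
      (fun x => inner x (e.symm x 1) (e.symm x 1)) e.baseSet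

namespace HermitianMetric

variable (h : HermitianMetric n L)

/-- The function `ĥ = h(s, s)` representing the metric with respect to the holomorphic frame
`s = e⁻¹(·, 1)` of `L` given by the trivialization `e`. -/
def localMetric (e : Trivialization ℂ (TotalSpace.proj : TotalSpace ℂ L → M)) (x : M) : ℝ :=
  (h.inner x (e.symm x 1) (e.symm x 1)).re

/-- The connection form `θ = ∂ log ĥ`, in the chart `φ` and the holomorphic frame given by `e`, of
the unique connection of `L` that is compatible with the metric and with the holomorphic
structure. Here `∂u(v) = (du(v) - i du(iv)) / 2`. -/
def connectionForm (φ : OpenPartialHomeomorph M (Fin n → ℂ))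
    (e : Trivialization ℂ (TotalSpace.proj : TotalSpace ℂ L → M)) (z v : Fin n → ℂ) : ℂ :=
  let u : (Fin n → ℂ) → ℝ := fun y => Real.log (h.localMetric e (φ.symm y))
  (((fderiv ℝ u z v : ℝ) : ℂ) - Complex.I * ((fderiv ℝ u z (Complex.I • v) : ℝ) : ℂ)) / 2

/-- The curvature `dθ = ∂̄∂ log ĥ` of that connection, evaluated on `(v, w)`. -/
def curvature (φ : OpenPartialHomeomorph M (Fin n → ℂ))
    (e : Trivialization ℂ (TotalSpace.proj : TotalSpace ℂ L → M)) (z v w : Fin n → ℂ) : ℂ :=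
  fderiv ℝ (fun y => h.connectionForm φ e y w) z v
    - fderiv ℝ (fun y => h.connectionForm φ e y v) z w

/-- The quantum condition `curv = -i ω`, equivalently `i ∂̄∂ log ĥ = ω`: the holomorphic
hermitian line bundle `(L, h)`, with its canonical connection, is a quantum line bundle for
`(M, ω)`. -/
def IsQuantum (κ : KahlerForm n M) : Prop :=
  ∀ φ ∈ atlas (Fin n → ℂ) M,
    ∀ (e : Trivialization ℂ (TotalSpace.proj : TotalSpace ℂ L → M)) [MemTrivializationAtlas e],
      ∀ z ∈ φ.target, φ.symm z ∈ e.baseSet → ∀ v w : Fin n → ℂ,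
        h.curvature φ e z v w = -Complex.I * ((formInChart κ.form φ z ![v, w] : ℝ) : ℂ)

/-- The metric `h^{(m)}` on `L^m`: with respect to the frame `s^{⊗m}` induced by a local frame `s`
of `L` it is `h^{(m)}(φ, ψ) = conj(φ̂) ψ̂ ĥ^m`. (This does not depend on the frame, see
`powInner_tprod`.) -/
def powInner (m : ℕ) (x : M) (φ ψ : ⨂[ℂ]^m (L x)) : ℂ :=
  let e := trivializationAt ℂ L x
  star (dualPow m (e.linearMapAt ℂ x) φ) * dualPow m (e.linearMapAt ℂ x) ψ
    * (h.localMetric e x : ℂ) ^ m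

/-- `h^{(m)}(u_1 ⊗ ⋯ ⊗ u_m, v_1 ⊗ ⋯ ⊗ v_m) = ∏ h(u_i, v_i)`. -/
theorem powInner_tprod (m : ℕ) (x : M) (u v : Fin m → L x) :
    h.powInner m x (PiTensorProduct.tprod ℂ u) (PiTensorProduct.tprod ℂ v)
      = ∏ i, h.inner x (u i) (v i) := by
  have hx : x ∈ (trivializationAt ℂ L x).baseSet := FiberBundle.mem_baseSet_trivializationAt' x
  set e := trivializationAt ℂ L x with he
  have key : ∀ a : L x, a = e.linearMapAt ℂ x a • e.symm x 1 := by
    intro a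
    have h1 : e.symmₗ ℂ x (e.linearMapAt ℂ x a) = a := e.symmₗ_linearMapAt hx a
    rw [← e.coe_symmₗ (R := ℂ) hx, ← map_smul, smul_eq_mul, mul_one, h1]
  have hreal : (h.localMetric e x : ℂ) = h.inner x (e.symm x 1) (e.symm x 1) :=
    Complex.conj_eq_iff_re.1 (h.conj_symm x _ _)
  have hloc : ∀ a b : L x, h.inner x a b
      = star (e.linearMapAt ℂ x a) * e.linearMapAt ℂ x b * (h.localMetric e x : ℂ) := by
    intro a b
    conv_lhs => rw [key a, key b]
    rw [hreal]
    simp only [LinearMap.map_smulₛₗ, LinearMap.smul_apply, map_smul, smul_eq_mul]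
    simp [mul_left_comm, mul_assoc]
  simp only [powInner, dualPow, ← he, PiTensorProduct.lift.tprod, MultilinearMap.compLinearMap_apply,
    MultilinearMap.mkPiAlgebra_apply, hloc, Finset.prod_mul_distrib, Finset.prod_const,
    Finset.card_univ, Fintype.card_fin, star_prod]

end HermitianMetric

variable (n L) in
/-- The space `Γ_hol(M, L^m)` of global holomorphic sections of the tensor power `L^m`: a section is
holomorphic if its coefficient with respect to the frame `s^{⊗m}` is holomorphic, for each local
holomorphic frame `s` of `L` given by a trivialization. -/
def holSections (m : ℕ) : Submodule ℂ (∀ x : M, ⨂[ℂ]^m (L x)) where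
  carrier := {s | ∀ (e : Trivialization ℂ (TotalSpace.proj : TotalSpace ℂ L → M))
    [MemTrivializationAtlas e],
    ContMDiffOn 𝓘(ℂ, Fin n → ℂ) 𝓘(ℂ, ℂ) ω
      (fun x => dualPow m (e.linearMapAt ℂ x) (s x)) e.baseSet}
  add_mem' := by
    intro s t hs ht e _
    refine ((hs e).add (ht e)).congr fun x _ => ?_
    simp only [Pi.add_apply, map_add]
  zero_mem' := by
    intro e _
    simpa only [Pi.zero_apply, map_zero] using contMDiffOn_const
  smul_mem' := by
    intro c s hs e _
    refine ((contMDiffOn_const (c := c)).mul (hs e)).congr fun x _ => ?_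
    simp only [Pi.smul_apply, map_smul, smul_eq_mul, Pi.mul_apply]

variable (n L) in
/-- `L` is very ample: the global holomorphic sections of `L` define an embedding of the compact
manifold `M` into projective space. The map sends `x` to the class of the linear form
`s ↦ α(s(x))` on the space of sections, where `α` is any nonzero element of the dual of the fibre
`L_x` (in terms of sections `s_0, …, s_N` it is `x ↦ (ŝ_0(x) : ⋯ : ŝ_N(x))`). It has to be
well defined, injective and immersive. -/
structure IsVeryAmple : Prop where
  wellDefined : ∀ (x : M) (α : L x →ₗ[ℂ] ℂ), α ≠ 0 →
    ∃ s : Cₛ^ω⟮𝓘(ℂ, Fin n → ℂ); ℂ, L⟯, α (s x) ≠ 0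
  injective : ∀ (x y : M) (α : L x →ₗ[ℂ] ℂ) (β : L y →ₗ[ℂ] ℂ), α ≠ 0 → β ≠ 0 →
    (∀ s : Cₛ^ω⟮𝓘(ℂ, Fin n → ℂ); ℂ, L⟯, α (s x) = β (s y)) → x = y
  /-- With `ŝ` the coefficient of `s` in a local frame near `x`, a tangent vector `v` is killed by
  the differential of the map to projective space iff `(dŝ_x(v))_s` is proportional to
  `(ŝ(x))_s`. -/
  immersive : ∀ (x : M) (v : TangentSpace 𝓘(ℂ, Fin n → ℂ) x) (c : ℂ),
    (∀ s : Cₛ^ω⟮𝓘(ℂ, Fin n → ℂ); ℂ, L⟯,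
      (show ℂ from mfderiv 𝓘(ℂ, Fin n → ℂ) 𝓘(ℂ, ℂ)
        (fun y => (trivializationAt ℂ L x).linearMapAt ℂ y (s y)) x v)
        = c * (trivializationAt ℂ L x).linearMapAt ℂ x (s x)) → v = 0

/-! ### Coherent vectors and covariant symbols -/

section Symbol

variable [T2Space M] [CompactSpace M] [MeasurableSpace M]
  (κ : KahlerForm n M) (h : HermitianMetric n L)

/-- The scalar product `⟨φ, ψ⟩ = ∫_M h^{(m)}(φ, ψ) Ω` of sections of `L^m`. -/
def scalarProduct (m : ℕ) (φ ψ : ∀ x : M, ⨂[ℂ]^m (L x)) : ℂ :=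
  ∫ x, h.powInner m x (φ x) (ψ x) ∂κ.liouville

/-- `e ∈ Γ_hol(M, L^m)` is a coherent vector of level `m` associated to the point `α` of the fibre
over `x` of the dual bundle: `⟨e, s⟩ = α^{⊗m}(s(x))` for all `s ∈ Γ_hol(M, L^m)`. -/
def IsCoherentVector (m : ℕ) (x : M) (α : L x →ₗ[ℂ] ℂ) (e : holSections n L m) : Prop :=
  ∀ s : holSections n L m, scalarProduct κ h m e.1 s.1 = dualPow m α (s.1 x)

open Classical in
/-- The coherent vector `e_α^{(m)}` associated to the point `α` over `x` of the dual bundle. -/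
def coherentVector (m : ℕ) (x : M) (α : L x →ₗ[ℂ] ℂ) : holSections n L m :=
  if H : ∃ e : holSections n L m, IsCoherentVector κ h m x α e then H.choose else 0

/-- The quotient `⟨e_α, A e_α⟩ / ⟨e_α, e_α⟩`, for a point `α` over `x` of the dual bundle. -/
def symbolAt (m : ℕ) (A : Module.End ℂ (holSections n L m)) (x : M) (α : L x →ₗ[ℂ] ℂ) : ℂ :=
  scalarProduct κ h m (coherentVector κ h m x α).1 (A (coherentVector κ h m x α)).1
    / scalarProduct κ h m (coherentVector κ h m x α).1 (coherentVector κ h m x α).1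

/-- The covariant Berezin symbol `σ^{(m)}(A) : M → ℂ`, computed with the nonzero point of the dual
bundle over `x` given by the preferred trivialization. -/
def covariantSymbol (m : ℕ) (A : Module.End ℂ (holSections n L m)) (x : M) : ℂ :=
  symbolAt κ h m A x ((trivializationAt ℂ L x).linearMapAt ℂ x)

end Symbol

end LineBundle

end BerezinToeplitz

end

/-! Fix an orthonormal basis (b_i) of the finite-dimensional Hilbert space of holomorphic sections
of L^m. The coherent vector is then e_α = ∑ conj(α^{⊗m}(b_i(x))) b_i, and in any holomorphic frame
the symbol of A is the quotient of ∑ conj(b_i) (A b_i) by ∑ |b_i|², sections being replaced by their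
coefficients (`covariantSymbol_eq`). Rescaling α multiplies both sums by the same positive factor,
and smoothness can be read off the quotient. The denominator does not vanish because a section of L
that is nonzero at x has an m-th tensor power that is nonzero at x.

Injectivity is a polarization argument. If two operators have the same symbol and C is their
difference, the kernel K(y, x) = ∑ conj(b_i(y)) (C b_i)(x) vanishes for y = x. It is antiholomorphic
in y and holomorphic in x, so it vanishes for all x, y in a small coordinate ball
(`sum_star_mul_eq_zero_of_diagonal`). The identity theorem on the connected manifold M
(`eq_zero_of_eqOn_isOpen`), applied first in x and then in y, turns this into C = 0.

The Hilbert space structure rests on two facts. Finite dimension follows from the Schwarz lemma and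
compactness (`exists_nhds_powNormSq_le`). Definiteness of the scalar product holds because the
Liouville measure charges every nonempty open set, which comes down to det(g) > 0
(`det_re_pos_of_form`). -/

namespace BerezinToeplitz

/-! ### Polarization of kernels -/

open ComplexConjugate in
/-- A kernel that is holomorphic in one variable and antiholomorphic in the other vanishes on a
convex open set as soon as it vanishes on the diagonal. -/
theorem sum_star_mul_eq_zero_of_diagonal {E ι : Type*} [NormedAddCommGroup E] [NormedSpace ℂ E]
    [Fintype ι] {B : Set E} (hBo : IsOpen B) (hBc : Convex ℝ B) {f g : ι → E → ℂ}
    (hf : ∀ i, DifferentiableOn ℂ (f i) B) (hg : ∀ i, DifferentiableOn ℂ (g i) B)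
    (h0 : ∀ z ∈ B, ∑ i, star (f i z) * g i z = 0) {a b : E} (ha : a ∈ B) (hb : b ∈ B) :
    ∑ i, star (f i b) * g i a = 0 := by
  -- Places a and b on one complex line s ↦ c + s d, at the conjugate parameters i and -i.
  obtain ⟨c, d, rfl, rfl⟩ : ∃ c d : E, a = c + Complex.I • d ∧ b = c + (-Complex.I) • d := by
    refine ⟨(2⁻¹ : ℂ) • (a + b), (-Complex.I * 2⁻¹) • (a - b), ?_, ?_⟩
    · rw [smul_smul, show Complex.I * (-Complex.I * 2⁻¹) = 2⁻¹ by
        rw [← mul_assoc, mul_neg, Complex.I_mul_I]; norm_num]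
      module
    · rw [smul_smul, show -Complex.I * (-Complex.I * 2⁻¹) = -2⁻¹ by
        rw [← mul_assoc, neg_mul_neg, Complex.I_mul_I]; norm_num]
      module
  let D : Set ℂ := {s | c + s • d ∈ B ∧ c + conj s • d ∈ B}
  -- The inner and outer conjugations cancel, so G is holomorphic. For real s it is the kernel on
  -- the diagonal; at s = i it is the value sought.
  let G : ℂ → ℂ := fun s => ∑ i, star (f i (c + conj s • d)) * g i (c + s • d)
  have hDo : IsOpen D :=
    (hBo.preimage (f := fun s : ℂ => c + s • d) (by fun_prop)).inter
      (hBo.preimage (f := fun s : ℂ => c + conj s • d) (by fun_prop))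
  have hDc : Convex ℝ D := by
    intro s hs t ht p q hp hq hpq
    have e1 : ∀ s t : ℂ, c + (p • s + q • t) • d = p • (c + s • d) + q • (c + t • d) := by
      intro s t
      have : c = p • c + q • c := by rw [← add_smul, hpq, one_smul]
      conv_lhs => rw [this]
      rw [add_smul, smul_assoc, smul_assoc]
      module
    refine ⟨?_, ?_⟩
    · rw [e1]; exact hBc hs.1 ht.1 hp hq hpq
    · have : conj (p • s + q • t) = p • conj s + q • conj t := by simp
      rw [this, e1]; exact hBc hs.2 ht.2 hp hq hpq
  have hI : Complex.I ∈ D := ⟨ha, by rw [Complex.conj_I]; exact hb⟩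
  have hI' : -Complex.I ∈ D := ⟨hb, by rw [map_neg, Complex.conj_I, neg_neg]; exact ha⟩
  have h0D : (0 : ℂ) ∈ D := by
    have := hDc hI hI' (a := 1 / 2) (b := 1 / 2) (by norm_num) (by norm_num) (by norm_num)
    simpa using this
  have hG : DifferentiableOn ℂ G D := by
    intro s hs
    refine (DifferentiableAt.fun_sum fun i _ => ?_).differentiableWithinAt
    have hline : ∀ t : ℂ, DifferentiableAt ℂ (fun s : ℂ => c + s • d) t := fun t => by fun_prop
    have h1 : DifferentiableAt ℂ (fun s : ℂ => g i (c + s • d)) s :=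
      DifferentiableAt.comp (g := g i) s ((hg i).differentiableAt (hBo.mem_nhds hs.1)) (hline s)
    have h2 : DifferentiableAt ℂ (fun s : ℂ => f i (c + s • d)) (conj s) :=
      DifferentiableAt.comp (g := f i) (conj s)
        ((hf i).differentiableAt (hBo.mem_nhds hs.2)) (hline _)
    have h3 := h2.conj_conj
    rw [Complex.conj_conj] at h3
    exact h3.mul h1
  -- The nonzero real parameters are zeros of G accumulating at 0, which is all the one-variable
  -- identity theorem needs.
  have hz : ∃ᶠ s in nhdsWithin (0 : ℂ) {0}ᶜ, G s = 0 := by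
    have hev : ∀ᶠ s in nhds (0 : ℂ), s ∈ D := hDo.mem_nhds h0D
    have hreal : Filter.Tendsto (fun t : ℝ => (t : ℂ)) (nhdsWithin 0 {0}ᶜ)
        (nhdsWithin 0 {0}ᶜ) := by
      refine tendsto_nhdsWithin_iff.2 ⟨?_, ?_⟩
      · have : Filter.Tendsto (fun t : ℝ => (t : ℂ)) (nhds 0) (nhds ((0 : ℝ) : ℂ)) :=
          Complex.continuous_ofReal.tendsto 0
        simpa using this.mono_left nhdsWithin_le_nhds
      · filter_upwards [self_mem_nhdsWithin] with t ht
        simpa using ht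
    refine hreal.frequently (Filter.Eventually.frequently ?_)
    filter_upwards [hreal.eventually (nhdsWithin_le_nhds hev)] with t ht
    have := h0 _ ht.1
    simpa only [G, Complex.conj_ofReal] using this
  have := (hG.analyticOnNhd hDo).eqOn_zero_of_preconnected_of_frequently_eq_zero
    hDc.isPreconnected h0D hz hI
  simpa only [G, Complex.conj_I, Pi.zero_apply] using this

/-! ### Linear algebra of positive (1,1)-forms -/

section OneOneForm

variable {n : ℕ} (W : (Fin n → ℂ) [⋀^Fin 2]→L[ℝ] ℝ)

/-- A continuous alternating two-form as a bilinear map. -/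
noncomputable def bilinOfForm : (Fin n → ℂ) →ₗ[ℝ] (Fin n → ℂ) →ₗ[ℝ] ℝ :=
  have hswap : ∀ v w, W ![v, w] = -W ![w, v] := fun v w => by
    refine Eq.trans ?_ (W.map_swap ![w, v] (i := 0) (j := 1) (by decide))
    change W _ = W _
    congr 1; ext i; fin_cases i <;> rfl
  have hadd : ∀ u v w, W ![u + v, w] = W ![u, w] + W ![v, w] := fun u v w =>
    W.toContinuousMultilinearMap.cons_add ![w] u v
  have hsmul : ∀ (c : ℝ) v w, W ![c • v, w] = c • W ![v, w] := fun c v w =>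
    W.toContinuousMultilinearMap.cons_smul ![w] c v
  LinearMap.mk₂ ℝ (fun v w => W ![v, w]) hadd hsmul
    (fun u v w => by rw [hswap, hadd, hswap u v, hswap u w, neg_add])
    (fun c v w => by rw [hswap, hsmul, hswap v w, smul_neg])

theorem bilinOfForm_apply (v w : Fin n → ℂ) : bilinOfForm W v w = W ![v, w] := rfl

theorem bilinOfForm_swap (v w : Fin n → ℂ) : bilinOfForm W v w = -bilinOfForm W w v := by
  refine Eq.trans ?_ (W.map_swap ![w, v] (i := 0) (j := 1) (by decide))
  change W _ = W _
  congr 1; ext i; fin_cases i <;> rfl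

variable {W} in
/-- The sesquilinear form `H(u, v) = W(u, iv) - i W(u, v)`, antilinear in `v`, attached to a
`J`-invariant alternating form. -/
noncomputable def sesqOfForm (hJ : ∀ v w, W ![Complex.I • v, Complex.I • w] = W ![v, w]) :
    (Fin n → ℂ) →ₗ[ℂ] (Fin n → ℂ) →ₗ⋆[ℂ] ℂ :=
  have hJ' : ∀ v w, bilinOfForm W (Complex.I • v) w = -bilinOfForm W v (Complex.I • w) :=
    fun v w => by
      have := hJ v (Complex.I • w)
      rw [smul_smul, Complex.I_mul_I, neg_one_smul] at this
      rw [bilinOfForm_apply W v, ← this, ← bilinOfForm_apply, map_neg, neg_neg]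
  have hc : ∀ (c : ℂ) (v : Fin n → ℂ), c • v = c.re • v + c.im • (Complex.I • v) := by
    intro c v
    ext i
    apply Complex.ext <;> simp <;> ring
  have hII : ∀ v : Fin n → ℂ, Complex.I • Complex.I • v = -v := fun v => by
    rw [smul_smul, Complex.I_mul_I, neg_one_smul]
  LinearMap.mk₂'ₛₗ (RingHom.id ℂ) (starRingEnd ℂ)
    (fun u v => (bilinOfForm W u (Complex.I • v) : ℂ) - Complex.I * (bilinOfForm W u v : ℂ))
    (fun u v w => by simp only [map_add, LinearMap.add_apply]; push_cast; ring)
    (fun c u v => by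
      rw [hc c u]
      simp only [map_add, LinearMap.add_apply, map_smul, LinearMap.smul_apply, hJ', hII,
        RingHom.id_apply, smul_eq_mul]
      apply Complex.ext <;> simp <;> ring)
    (fun u v w => by simp only [smul_add, map_add]; push_cast; ring)
    (fun c u v => by
      rw [smul_comm, hc c (Complex.I • v), hc c v, hII]
      simp only [map_add, map_smul, smul_neg, map_neg, smul_eq_mul]
      apply Complex.ext <;> (simp; ring))

open scoped ComplexOrder in
/-- The matrix `(W(e_j, i e_k) - i W(e_j, e_k)) / 2` of a positive `J`-invariant alternating form
has positive determinant. -/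
theorem det_re_pos_of_form (hJ : ∀ v w, W ![Complex.I • v, Complex.I • w] = W ![v, w])
    (hpos : ∀ v, v ≠ 0 → 0 < W ![v, Complex.I • v]) :
    0 < (Matrix.det (fun j k : Fin n =>
      (((W ![Pi.single j 1, Pi.single k Complex.I] : ℝ) : ℂ)
        - Complex.I * ((W ![Pi.single j 1, Pi.single k 1] : ℝ) : ℂ)) / 2)).re := by
  set G : Matrix (Fin n) (Fin n) ℂ := fun j k : Fin n =>
      (((W ![Pi.single j 1, Pi.single k Complex.I] : ℝ) : ℂ)
        - Complex.I * ((W ![Pi.single j 1, Pi.single k 1] : ℝ) : ℂ)) / 2 with hG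
  have hGH : ∀ j k, G j k = sesqOfForm hJ (Pi.single j 1) (Pi.single k 1) / 2 := by
    intro j k
    have : (Pi.single k Complex.I : Fin n → ℂ) = Complex.I • Pi.single k 1 := by
      rw [← Pi.single_smul, smul_eq_mul, mul_one]
    simp only [hG, this]
    rfl
  have hHconj : ∀ u v, star (sesqOfForm hJ u v) = sesqOfForm hJ v u := by
    intro u v
    have h1 : bilinOfForm W u (Complex.I • v) = bilinOfForm W v (Complex.I • u) := by
      rw [bilinOfForm_swap, bilinOfForm_apply, ← hJ, smul_smul, Complex.I_mul_I, neg_one_smul,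
        ← bilinOfForm_apply, map_neg, LinearMap.neg_apply, neg_neg]
    change star ((bilinOfForm W u (Complex.I • v) : ℂ) - Complex.I * (bilinOfForm W u v : ℂ))
      = (bilinOfForm W v (Complex.I • u) : ℂ) - Complex.I * (bilinOfForm W v u : ℂ)
    rw [h1, bilinOfForm_swap W u v]
    apply Complex.ext <;> simp
  have hHself : ∀ u, sesqOfForm hJ u u = (W ![u, Complex.I • u] : ℂ) := by
    intro u
    have h1 : bilinOfForm W u u = 0 := by linarith [bilinOfForm_swap W u u]
    change (bilinOfForm W u (Complex.I • u) : ℂ) - Complex.I * (bilinOfForm W u u : ℂ) = _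
    rw [h1, bilinOfForm_apply]; simp
  -- The form is linear in its first slot and antilinear in its second, so the quadratic form of G
  -- at x is its value at the conjugate vector. This is harmless for positivity.
  have hquad : ∀ x : Fin n → ℂ, star x ⬝ᵥ (G.mulVec x) = sesqOfForm hJ (star x) (star x) / 2 := by
    intro x
    have hx : star x = ∑ i, star (x i) • (Pi.single i 1 : Fin n → ℂ) := by
      ext j; simp [Finset.sum_apply, Pi.single_apply]
    conv_rhs => rw [hx]
    simp only [map_sum, LinearMap.sum_apply, map_smul, LinearMap.smul_apply, LinearMap.map_smulₛₗ,
      dotProduct, Matrix.mulVec, hGH, Finset.sum_div, Finset.mul_sum, smul_eq_mul, Pi.star_apply]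
    rw [Finset.sum_comm]
    refine Finset.sum_congr rfl fun i _ => Finset.sum_congr rfl fun j _ => ?_
    simp
    ring
  have hPD : G.PosDef := by
    refine Matrix.PosDef.of_dotProduct_mulVec_pos ?_ ?_
    · ext j k
      rw [Matrix.conjTranspose_apply, hGH, hGH, star_div₀, hHconj]
      simp
    · intro x hx
      rw [hquad, hHself]
      have := hpos (star x) (star_ne_zero.2 hx)
      rw [← Complex.ofReal_ofNat, ← Complex.ofReal_div, Complex.zero_lt_real]
      positivity
  exact (Complex.lt_def.1 hPD.det_pos).1

end OneOneForm

/-- A positive definite hermitian form on a finite-dimensional complex space has an orthonormal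
basis. -/
theorem exists_orthonormal_basis {V : Type*} [AddCommGroup V] [Module ℂ V] [FiniteDimensional ℂ V]
    (c : InnerProductSpace.Core ℂ V) :
    ∃ (N : ℕ) (b : Module.Basis (Fin N) ℂ V), ∀ i j, c.inner (b i) (b j) = if i = j then 1 else 0 := by
  let _ : NormedAddCommGroup V := c.toNormedAddCommGroup
  let _ : InnerProductSpace ℂ V := InnerProductSpace.ofCore c.toCore
  let b := stdOrthonormalBasis ℂ V
  refine ⟨_, b.toBasis, fun i j => ?_⟩
  have := orthonormal_iff_ite.1 b.orthonormal i j
  simpa using this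

/-! ### The Liouville measure is finite and has full support -/

section Liouville

variable {n : ℕ} {M : Type*} [TopologicalSpace M] [ChartedSpace (Fin n → ℂ) M]

section Chart

variable [IsManifold 𝓘(ℂ, Fin n → ℂ) ω M]
  {φ : OpenPartialHomeomorph M (Fin n → ℂ)} (hφ : φ ∈ atlas (Fin n → ℂ) M)
  {z : Fin n → ℂ} (hz : z ∈ φ.target)

include hφ hz

/-- The real differential of the inverse of a holomorphic chart is the complex one. -/
theorem mfderiv_real_symm_apply (v : Fin n → ℂ) :
    (mfderiv 𝓘(ℝ, Fin n → ℂ) 𝓘(ℝ, Fin n → ℂ) φ.symm z v : Fin n → ℂ)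
      = mfderiv 𝓘(ℂ, Fin n → ℂ) 𝓘(ℂ, Fin n → ℂ) φ.symm z v := by
  have : IsManifold 𝓘(ℂ, Fin n → ℂ) 1 M := IsManifold.of_le (n := ω) le_top
  have hd := (mdifferentiableAt_atlas_symm (I := 𝓘(ℂ, Fin n → ℂ)) hφ hz).hasMFDerivAt
  let T : (Fin n → ℂ) →L[ℂ] (Fin n → ℂ) := mfderiv 𝓘(ℂ, Fin n → ℂ) 𝓘(ℂ, Fin n → ℂ) φ.symm z
  have hr : HasMFDerivAt 𝓘(ℝ, Fin n → ℂ) 𝓘(ℝ, Fin n → ℂ) φ.symm z (T.restrictScalars ℝ) :=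
    ⟨hd.1, HasFDerivWithinAt.restrictScalars ℝ hd.2⟩
  rw [hr.mfderiv]
  rfl

/-- The differential T of the inverse of a holomorphic chart is ℂ-linear, so it commutes with J and
`type_one_one` carries over to coordinates. -/
theorem formInChart_complexStructure (κ : KahlerForm n M) (v w : Fin n → ℂ) :
    formInChart κ.form φ z ![Complex.I • v, Complex.I • w] = formInChart κ.form φ z ![v, w] := by
  let T : (Fin n → ℂ) →L[ℂ] (Fin n → ℂ) := mfderiv 𝓘(ℂ, Fin n → ℂ) 𝓘(ℂ, Fin n → ℂ) φ.symm z
  have key : ∀ v w : Fin n → ℂ, formInChart κ.form φ z ![v, w]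
      = κ.form (φ.symm z) ![(T v : Fin n → ℂ), (T w : Fin n → ℂ)] := by
    intro v w
    change κ.form (φ.symm z) _ = _
    congr 1
    ext i
    fin_cases i
    · exact mfderiv_real_symm_apply hφ hz v
    · exact mfderiv_real_symm_apply hφ hz w
  rw [key, key, map_smul, map_smul]
  exact κ.type_one_one (φ.symm z) (T v) (T w)

theorem formInChart_pos (κ : KahlerForm n M) (v : Fin n → ℂ) (hv : v ≠ 0) :
    0 < formInChart κ.form φ z ![v, Complex.I • v] := by
  have : IsManifold 𝓘(ℂ, Fin n → ℂ) 1 M := IsManifold.of_le (n := ω) le_top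
  let T : (Fin n → ℂ) →L[ℂ] (Fin n → ℂ) := mfderiv 𝓘(ℂ, Fin n → ℂ) 𝓘(ℂ, Fin n → ℂ) φ.symm z
  have hT : T v ≠ 0 := by
    intro h0
    have := (mdifferentiable_of_mem_atlas (I := 𝓘(ℂ, Fin n → ℂ)) hφ).symm.mfderiv_injective
      (x := z) hz
    exact hv (this (h0.trans (map_zero T).symm))
  have key : formInChart κ.form φ z ![v, Complex.I • v]
      = κ.form (φ.symm z) ![(T v : Fin n → ℂ), (Complex.I • T v : Fin n → ℂ)] := by
    rw [← map_smul]
    change κ.form (φ.symm z) _ = _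
    congr 1
    ext i
    fin_cases i
    · exact mfderiv_real_symm_apply hφ hz v
    · exact mfderiv_real_symm_apply hφ hz _
  rw [key]
  exact κ.pos (φ.symm z) (T v) hT

theorem liouvilleDensity_pos (κ : KahlerForm n M) : 0 < κ.liouvilleDensity φ z :=
  mul_pos (by positivity)
    (det_re_pos_of_form (W := formInChart κ.form φ z) (formInChart_complexStructure hφ hz κ)
      (formInChart_pos hφ hz κ))

end Chart

theorem continuousOn_liouvilleDensity (κ : KahlerForm n M)
    {φ : OpenPartialHomeomorph M (Fin n → ℂ)} (hφ : φ ∈ atlas (Fin n → ℂ) M) :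
    ContinuousOn (κ.liouvilleDensity φ) φ.target := by
  have hform := (κ.smooth φ hφ).continuousOn
  have hev : ∀ v : Fin 2 → Fin n → ℂ,
      ContinuousOn (fun z => formInChart κ.form φ z v) φ.target := fun v =>
    (ContinuousAlternatingMap.apply ℝ (Fin n → ℂ) ℝ v).continuous.comp_continuousOn hform
  have hcoeff : ContinuousOn (κ.coeff φ) φ.target := by
    refine continuousOn_pi.2 fun j => continuousOn_pi.2 fun k => ?_
    refine ContinuousOn.div_const (ContinuousOn.sub ?_ (continuousOn_const.mul ?_)) _
    · exact Complex.continuous_ofReal.comp_continuousOn (hev _)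
    · exact Complex.continuous_ofReal.comp_continuousOn (hev _)
  exact continuousOn_const.mul (Complex.continuous_re.comp_continuousOn
    (Continuous.comp_continuousOn (Continuous.matrix_det continuous_id) hcoeff))

variable [T2Space M] [CompactSpace M]

theorem chartPartition_isSubordinate :
    (chartPartition n M).IsSubordinate fun p : M => (chartAt (Fin n → ℂ) p).source :=
  (exists_chart_partition n M).choose_spec

theorem continuousOn_chartPartition_mul_liouvilleDensity (κ : KahlerForm n M) (p : M) :
    ContinuousOn (fun z => chartPartition n M p ((chartAt (Fin n → ℂ) p).symm z) *
      κ.liouvilleDensity (chartAt (Fin n → ℂ) p) z) (chartAt (Fin n → ℂ) p).target :=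
  ((chartPartition n M p).continuous.comp_continuousOn
    (chartAt (Fin n → ℂ) p).continuousOn_symm).mul
      (continuousOn_liouvilleDensity κ (chart_mem_atlas _ p))

variable [MeasurableSpace M] [BorelSpace M]

omit [T2Space M] [CompactSpace M] in
theorem aemeasurable_chartAt_symm (p : M) (f : (Fin n → ℂ) → ENNReal) :
    AEMeasurable (chartAt (Fin n → ℂ) p).symm
      ((volume.restrict (chartAt (Fin n → ℂ) p).target).withDensity f) :=
  ((chartAt (Fin n → ℂ) p).continuousOn_symm.aemeasurable
    (chartAt (Fin n → ℂ) p).open_target.measurableSet).mono_ac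
      (withDensity_absolutelyContinuous _ _)

/-- By local finiteness and compactness only finitely many partition functions are nonzero. The
density of each summand is continuous and vanishes outside the compact image K of a support, hence
is bounded there. -/
instance isFiniteMeasure_liouville (κ : KahlerForm n M) : IsFiniteMeasure κ.liouville := by
  refine ⟨?_⟩
  rw [KahlerForm.liouville, Measure.sum_apply _ MeasurableSet.univ]
  have hfin : {p : M | (Function.support (chartPartition n M p)).Nonempty}.Finite :=
    (chartPartition n M).locallyFinite.finite_nonempty_of_compact
  rw [tsum_eq_sum (s := hfin.toFinset) ?_]
  · refine ENNReal.sum_lt_top.2 fun p _ => ?_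
    rw [Measure.map_apply_of_aemeasurable (aemeasurable_chartAt_symm p _) MeasurableSet.univ,
      Set.preimage_univ, withDensity_apply _ MeasurableSet.univ, Measure.restrict_univ]
    have hsub := chartPartition_isSubordinate (n := n) (M := M) p
    have hK : IsCompact (chartAt (Fin n → ℂ) p '' tsupport (chartPartition n M p)) :=
      (isClosed_tsupport _).isCompact.image_of_continuousOn
        ((chartAt (Fin n → ℂ) p).continuousOn.mono hsub)
    set K := chartAt (Fin n → ℂ) p '' tsupport (chartPartition n M p) with hKdef
    have hKt : K ⊆ (chartAt (Fin n → ℂ) p).target := by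
      rintro _ ⟨x, hx, rfl⟩
      exact (chartAt (Fin n → ℂ) p).map_source (hsub hx)
    obtain ⟨C, hC⟩ := hK.exists_bound_of_continuousOn
      ((continuousOn_chartPartition_mul_liouvilleDensity κ p).mono hKt)
    calc _ ≤ ∫⁻ z in (chartAt (Fin n → ℂ) p).target,
          K.indicator (fun _ => ENNReal.ofReal C) z := by
          refine setLIntegral_mono' (chartAt (Fin n → ℂ) p).open_target.measurableSet ?_
          intro z hz
          by_cases hzK : z ∈ K
          · rw [Set.indicator_of_mem hzK]
            exact ENNReal.ofReal_le_ofReal ((le_abs_self _).trans (hC z hzK))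
          · have : chartPartition n M p ((chartAt (Fin n → ℂ) p).symm z) = 0 := by
              by_contra h0
              exact hzK ⟨_, subset_tsupport _ h0, (chartAt (Fin n → ℂ) p).right_inv hz⟩
            simp [this]
      _ ≤ ∫⁻ z, K.indicator (fun _ => ENNReal.ofReal C) z := setLIntegral_le_lintegral _ _
      _ = ENNReal.ofReal C * volume K := lintegral_indicator_const hK.measurableSet _
      _ < ⊤ := ENNReal.mul_lt_top ENNReal.ofReal_lt_top hK.measure_lt_top
  · intro p hp
    have h0 : ∀ x, chartPartition n M p x = 0 := by
      intro x
      by_contra hx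
      exact hp (hfin.mem_toFinset.2 ⟨x, hx⟩)
    simp [h0]

/-- A single summand suffices: pick p with ρ_p(x) > 0. The density is then strictly positive on the
nonempty open set V of coordinates of points of U where ρ_p > 0, and V has positive Lebesgue
measure. -/
instance isOpenPosMeasure_liouville [IsManifold 𝓘(ℂ, Fin n → ℂ) ω M] (κ : KahlerForm n M) :
    κ.liouville.IsOpenPosMeasure := by
  refine ⟨fun U hU ⟨x, hx⟩ h0 => ?_⟩
  obtain ⟨p, hp⟩ := (chartPartition n M).exists_pos (Set.mem_univ x)
  have hxs : x ∈ (chartAt (Fin n → ℂ) p).source :=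
    chartPartition_isSubordinate p (subset_tsupport _ hp.ne')
  have hle := Measure.le_sum (fun p : M =>
    Measure.map (chartAt (Fin n → ℂ) p).symm
      ((volume.restrict (chartAt (Fin n → ℂ) p).target).withDensity fun z =>
        ENNReal.ofReal (chartPartition n M p ((chartAt (Fin n → ℂ) p).symm z) *
          κ.liouvilleDensity (chartAt (Fin n → ℂ) p) z))) p
  have h1 := le_antisymm ((hle U).trans_eq h0) bot_le
  rw [Measure.map_apply_of_aemeasurable (aemeasurable_chartAt_symm p _) hU.measurableSet,
    withDensity_apply_eq_zero'
      (((continuousOn_chartPartition_mul_liouvilleDensity κ p).aemeasurable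
        (chartAt (Fin n → ℂ) p).open_target.measurableSet).ennreal_ofReal)] at h1
  set φ := chartAt (Fin n → ℂ) p with hφ
  set V := φ.target ∩ φ.symm ⁻¹' (U ∩ {y | 0 < chartPartition n M p y}) with hV
  have hVo : IsOpen V := φ.isOpen_inter_preimage_symm
    (hU.inter (isOpen_lt continuous_const (chartPartition n M p).continuous))
  have hVne : V.Nonempty := ⟨φ x, φ.map_source hxs, by
    rw [Set.mem_preimage, φ.left_inv hxs]
    exact ⟨hx, hp⟩⟩
  refine (hVo.measure_pos volume hVne).ne' ?_
  rw [← Measure.restrict_eq_self volume (Set.inter_subset_left : V ⊆ φ.target)]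
  refine measure_mono_null (fun z (hz : z ∈ V) => ?_) h1
  exact ⟨(ENNReal.ofReal_pos.2
    (mul_pos hz.2.2 (liouvilleDensity_pos (chart_mem_atlas _ p) hz.1 κ))).ne', hz.2.1⟩

end Liouville

/-! ### Tensor powers of a line and the metric on L^m -/

theorem dualPow_tprod (m : ℕ) {V : Type*} [AddCommGroup V] [Module ℂ V] (α : V →ₗ[ℂ] ℂ)
    (v : Fin m → V) : dualPow m α (PiTensorProduct.tprod ℂ v) = ∏ i, α (v i) := by
  simp [dualPow, PiTensorProduct.lift.tprod]

theorem dualPow_smul (m : ℕ) {V : Type*} [AddCommGroup V] [Module ℂ V] (c : ℂ) (α : V →ₗ[ℂ] ℂ)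
    (t : ⨂[ℂ]^m V) : dualPow m (c • α) t = c ^ m * dualPow m α t := by
  have : dualPow m (c • α) = c ^ m • dualPow m α := by
    refine PiTensorProduct.ext (MultilinearMap.ext fun v => ?_)
    simp only [LinearMap.compMultilinearMap_apply, LinearMap.smul_apply, dualPow_tprod,
      smul_eq_mul, Finset.prod_mul_distrib, Finset.prod_const, Finset.card_univ, Fintype.card_fin]
  rw [this, LinearMap.smul_apply, smul_eq_mul]

section LineBundle

variable {n : ℕ} {M : Type*} [TopologicalSpace M]
  {L : M → Type*} [∀ x, AddCommGroup (L x)] [∀ x, Module ℂ (L x)]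
  [TopologicalSpace (TotalSpace ℂ L)]

section Fibre

variable (e : Trivialization ℂ (TotalSpace.proj : TotalSpace ℂ L → M)) [e.IsLinear ℂ] {x : M}
  (hx : x ∈ e.baseSet)

include hx

theorem linearMapAt_smul_symm (a : L x) : e.linearMapAt ℂ x a • e.symm x 1 = a := by
  have h1 : e.symmₗ ℂ x (e.linearMapAt ℂ x a) = a := e.symmₗ_linearMapAt hx a
  rw [← e.coe_symmₗ (R := ℂ) hx, ← map_smul, smul_eq_mul, mul_one, h1]

theorem linearMapAt_symm_one : e.linearMapAt ℂ x (e.symm x 1) = 1 := by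
  rw [← e.coe_symmₗ (R := ℂ) hx, e.linearMapAt_symmₗ hx]

theorem eq_smul_linearMapAt (α : L x →ₗ[ℂ] ℂ) : α = α (e.symm x 1) • e.linearMapAt ℂ x := by
  ext a
  conv_lhs => rw [← linearMapAt_smul_symm e hx a]
  simp [mul_comm]

theorem linearMapAt_ne_zero : e.linearMapAt ℂ x ≠ 0 := fun h0 => by
  have := linearMapAt_symm_one e hx
  simp [h0] at this

/-- The fibre of L^m is a line spanned by the m-th power of the frame. This is what lets a vector of
L^m be tested by its single coefficient. -/
theorem dualPow_smul_tprod_symm (m : ℕ) (t : ⨂[ℂ]^m (L x)) :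
    dualPow m (e.linearMapAt ℂ x) t • PiTensorProduct.tprod ℂ (fun _ => e.symm x 1) = t := by
  have : (dualPow m (e.linearMapAt ℂ x)).smulRight
      (PiTensorProduct.tprod ℂ (fun _ : Fin m => e.symm x 1)) = LinearMap.id := by
    refine PiTensorProduct.ext (MultilinearMap.ext fun v => ?_)
    simp only [LinearMap.compMultilinearMap_apply, LinearMap.smulRight_apply, dualPow_tprod,
      LinearMap.id_apply]
    rw [← MultilinearMap.map_smul_univ]
    congr 1
    funext i
    exact linearMapAt_smul_symm e hx (v i)
  exact LinearMap.congr_fun this t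

theorem eq_zero_of_dualPow_linearMapAt {m : ℕ} {t : ⨂[ℂ]^m (L x)}
    (h0 : dualPow m (e.linearMapAt ℂ x) t = 0) : t = 0 := by
  rw [← dualPow_smul_tprod_symm e hx m t, h0, zero_smul]

end Fibre

variable [∀ x, TopologicalSpace (L x)] [FiberBundle ℂ L] [ChartedSpace (Fin n → ℂ) M]
  [VectorBundle ℂ ℂ L]

namespace HermitianMetric

variable (h : HermitianMetric n L)

section

variable (e : Trivialization ℂ (TotalSpace.proj : TotalSpace ℂ L → M)) [MemTrivializationAtlas e]

theorem localMetric_pos {x : M} (hx : x ∈ e.baseSet) : 0 < h.localMetric e x := by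
  refine h.pos x _ fun h0 => ?_
  have := linearMapAt_symm_one e hx
  simp [h0] at this

omit [VectorBundle ℂ ℂ L] in
theorem continuousOn_localMetric : ContinuousOn (h.localMetric e) e.baseSet :=
  Complex.continuous_re.comp_continuousOn (h.smooth e).continuousOn

/-- The metric `h^{(m)}` can be computed in any local frame. -/
theorem powInner_eq {x : M} (hx : x ∈ e.baseSet) (m : ℕ) (s t : ⨂[ℂ]^m (L x)) :
    h.powInner m x s t = star (dualPow m (e.linearMapAt ℂ x) s) * dualPow m (e.linearMapAt ℂ x) t
      * (h.localMetric e x : ℂ) ^ m := by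
  have hx₀ : x ∈ (trivializationAt ℂ L x).baseSet := FiberBundle.mem_baseSet_trivializationAt' x
  set e₀ := trivializationAt ℂ L x with he₀
  -- The transition factor between the two frames: the local metric picks up |c|², each coefficient
  -- of L^m picks up a power of c, and the factors match.
  set c := e₀.linearMapAt ℂ x (e.symm x 1) with hc
  have hloc : (h.localMetric e x : ℂ) = star c * c * h.localMetric e₀ x := by
    have hr : ∀ v, ((h.inner x v v).re : ℂ) = h.inner x v v := fun v =>
      Complex.conj_eq_iff_re.1 (h.conj_symm x v v)
    have hs : e.symm x 1 = c • e₀.symm x 1 := (linearMapAt_smul_symm e₀ hx₀ _).symm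
    rw [localMetric, localMetric, hr, hr, hs]
    simp only [LinearMap.map_smulₛₗ, LinearMap.smul_apply, map_smul, smul_eq_mul,
      starRingEnd_apply]
    ring
  have h₀ := eq_smul_linearMapAt e hx (e₀.linearMapAt ℂ x)
  rw [← hc] at h₀
  change star (dualPow m (e₀.linearMapAt ℂ x) s) * dualPow m (e₀.linearMapAt ℂ x) t
    * (h.localMetric e₀ x : ℂ) ^ m = _
  rw [h₀, dualPow_smul, dualPow_smul, hloc, star_mul', star_pow]
  ring

end

theorem star_powInner (m : ℕ) (x : M) (s t : ⨂[ℂ]^m (L x)) :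
    star (h.powInner m x s t) = h.powInner m x t s := by
  simp only [powInner, star_mul', star_pow, Complex.star_def, Complex.conj_ofReal,
    Complex.conj_conj]
  ring

/-- The square of the pointwise norm on `L^m` defined by `h^{(m)}`. -/
noncomputable def powNormSq (m : ℕ) (x : M) (s : ⨂[ℂ]^m (L x)) : ℝ := (h.powInner m x s s).re

theorem powNormSq_eq (e : Trivialization ℂ (TotalSpace.proj : TotalSpace ℂ L → M))
    [MemTrivializationAtlas e] {x : M} (hx : x ∈ e.baseSet) (m : ℕ) (s : ⨂[ℂ]^m (L x)) :
    h.powNormSq m x s = ‖dualPow m (e.linearMapAt ℂ x) s‖ ^ 2 * h.localMetric e x ^ m := by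
  rw [powNormSq, h.powInner_eq e hx, Complex.star_def, Complex.conj_mul']
  norm_cast

theorem powNormSq_nonneg (m : ℕ) (x : M) (s : ⨂[ℂ]^m (L x)) : 0 ≤ h.powNormSq m x s := by
  have hx : x ∈ (trivializationAt ℂ L x).baseSet := FiberBundle.mem_baseSet_trivializationAt' x
  rw [h.powNormSq_eq _ hx]
  have := h.localMetric_pos _ hx
  positivity

theorem eq_zero_of_powNormSq {m : ℕ} {x : M} {s : ⨂[ℂ]^m (L x)} (h0 : h.powNormSq m x s = 0) :
    s = 0 := by
  have hx : x ∈ (trivializationAt ℂ L x).baseSet := FiberBundle.mem_baseSet_trivializationAt' x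
  rw [h.powNormSq_eq _ hx] at h0
  have := h.localMetric_pos _ hx
  refine eq_zero_of_dualPow_linearMapAt _ hx ?_
  simpa [this.ne'] using h0

theorem powInner_self (m : ℕ) (x : M) (s : ⨂[ℂ]^m (L x)) :
    h.powInner m x s s = h.powNormSq m x s :=
  (Complex.conj_eq_iff_re.1 (h.star_powInner m x s s)).symm

end HermitianMetric

/-! ### Holomorphic sections: identity theorem and finite dimension -/

section HolSections

variable {m : ℕ}

theorem continuousOn_coeff (s : holSections n L m)
    (e : Trivialization ℂ (TotalSpace.proj : TotalSpace ℂ L → M)) [MemTrivializationAtlas e] :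
    ContinuousOn (fun x => dualPow m (e.linearMapAt ℂ x) (s.1 x)) e.baseSet :=
  (s.2 e).continuousOn

theorem continuous_powInner (h : HermitianMetric n L) (s t : holSections n L m) :
    Continuous fun x => h.powInner m x (s.1 x) (t.1 x) := by
  refine continuous_iff_continuousAt.2 fun p => ?_
  have hp : p ∈ (trivializationAt ℂ L p).baseSet := FiberBundle.mem_baseSet_trivializationAt' p
  set e := trivializationAt ℂ L p
  have hc : ContinuousOn (fun x => star (dualPow m (e.linearMapAt ℂ x) (s.1 x))
      * dualPow m (e.linearMapAt ℂ x) (t.1 x) * (h.localMetric e x : ℂ) ^ m) e.baseSet :=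
    ((continuous_star.comp_continuousOn (continuousOn_coeff s e)).mul (continuousOn_coeff t e)).mul
      ((Complex.continuous_ofReal.comp_continuousOn (h.continuousOn_localMetric e)).pow m)
  exact (hc.congr fun x hx => h.powInner_eq e hx m _ _).continuousAt (e.open_baseSet.mem_nhds hp)

theorem continuous_powNormSq (h : HermitianMetric n L) (s : holSections n L m) :
    Continuous fun x => h.powNormSq m x (s.1 x) :=
  Complex.continuous_re.comp (continuous_powInner h s s)

variable [IsManifold 𝓘(ℂ, Fin n → ℂ) ω M]

theorem contDiffOn_coeff_chart (s : holSections n L m)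
    (e : Trivialization ℂ (TotalSpace.proj : TotalSpace ℂ L → M)) [MemTrivializationAtlas e]
    (p : M) :
    ContDiffOn ℂ ω (fun z => dualPow m (e.linearMapAt ℂ ((chartAt (Fin n → ℂ) p).symm z))
        (s.1 ((chartAt (Fin n → ℂ) p).symm z)))
      ((chartAt (Fin n → ℂ) p).target ∩ (chartAt (Fin n → ℂ) p).symm ⁻¹' e.baseSet) := by
  have := (contMDiffOn_iff.1 (s.2 e)).2 p 0
  simpa [Function.comp_def, chartAt_self_eq] using this

omit [∀ x, AddCommGroup (L x)] [∀ x, Module ℂ (L x)] [VectorBundle ℂ ℂ L]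
  [IsManifold 𝓘(ℂ, Fin n → ℂ) ω M] in
theorem exists_ball_subset (p : M) :
    ∃ R > 0, Metric.ball (chartAt (Fin n → ℂ) p p) R ⊆ (chartAt (Fin n → ℂ) p).target ∩
      (chartAt (Fin n → ℂ) p).symm ⁻¹' (trivializationAt ℂ L p).baseSet := by
  refine Metric.isOpen_iff.1 ((chartAt (Fin n → ℂ) p).isOpen_inter_preimage_symm
    (trivializationAt ℂ L p).open_baseSet) _ ⟨mem_chart_target _ p, ?_⟩
  rw [Set.mem_preimage, (chartAt (Fin n → ℂ) p).left_inv (mem_chart_source _ p)]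
  exact FiberBundle.mem_baseSet_trivializationAt' p

/-- Identity theorem: a holomorphic section of `L^m` over a connected manifold that vanishes on a
nonempty open set is zero. -/
theorem eq_zero_of_eqOn_isOpen [ConnectedSpace M] (s : holSections n L m) {U : Set M}
    (hU : IsOpen U) (hne : U.Nonempty) (h0 : ∀ x ∈ U, s.1 x = 0) : s = 0 := by
  have hopen : IsOpen (interior {x | s.1 x = 0}) := isOpen_interior
  -- A coordinate ball around a limit point p meets the interior of the zero set, so the analytic
  -- coefficient of s vanishes on the whole ball and p is interior too.
  have hclosed : IsClosed (interior {x | s.1 x = 0}) := by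
    refine isClosed_of_closure_subset fun p hp => ?_
    obtain ⟨R, hR, hsub⟩ := exists_ball_subset (n := n) (L := L) p
    set φ := chartAt (Fin n → ℂ) p with hφ
    set e := trivializationAt ℂ L p with he
    set N := φ.source ∩ φ ⁻¹' Metric.ball (φ p) R with hN
    have hNo : IsOpen N := φ.isOpen_inter_preimage Metric.isOpen_ball
    have hpN : p ∈ N := ⟨mem_chart_source _ p, Metric.mem_ball_self hR⟩
    obtain ⟨y, hyN, hyZ⟩ := mem_closure_iff.1 hp N hNo hpN
    have han := Metric.isOpen_ball.analyticOn_iff_analyticOnNhd.1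
      ((contDiffOn_coeff_chart s e p).mono hsub).analyticOn
    have hev : (fun z => dualPow m (e.linearMapAt ℂ (φ.symm z)) (s.1 (φ.symm z)))
        =ᶠ[nhds (φ y)] 0 := by
      have hc : ContinuousAt φ.symm (φ y) := φ.continuousAt_symm (φ.map_source hyN.1)
      have hy : interior {x | s.1 x = 0} ∈ nhds (φ.symm (φ y)) := by
        rw [φ.left_inv hyN.1]; exact hopen.mem_nhds hyZ
      filter_upwards [hc hy] with z hz
      have hz' : φ.symm z ∈ {x | s.1 x = 0} := interior_subset hz
      have : s.1 (φ.symm z) = 0 := hz'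
      simp [this]
    have hz := han.eqOn_zero_of_preconnected_of_eventuallyEq_zero
      (convex_ball (φ p) R).isPreconnected hyN.2 hev
    refine mem_interior.2 ⟨N, fun x hx => ?_, hNo, hpN⟩
    have h1 : dualPow m (e.linearMapAt ℂ (φ.symm (φ x))) (s.1 (φ.symm (φ x))) = 0 := hz hx.2
    have h2 : φ.symm (φ x) ∈ e.baseSet := (hsub hx.2).2
    rw [φ.left_inv hx.1] at h1 h2
    exact eq_zero_of_dualPow_linearMapAt e h2 h1
  have huniv := IsClopen.eq_univ ⟨hclosed, hopen⟩
    (hne.mono fun x hx => mem_interior.2 ⟨U, h0, hU, hx⟩)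
  refine Subtype.ext (funext fun x => ?_)
  have hx : x ∈ interior {x | s.1 x = 0} := by rw [huniv]; trivial
  exact (interior_subset hx : x ∈ {x | s.1 x = 0})

/-- By the Schwarz lemma, a section vanishing at `p` is small near `p`. -/
theorem exists_nhds_powNormSq_le (h : HermitianMetric n L) (m : ℕ) (p : M) :
    ∃ V ∈ nhds p, ∀ s : holSections n L m, s.1 p = 0 → ∀ S : ℝ,
      (∀ y, h.powNormSq m y (s.1 y) ≤ S) → ∀ x ∈ V, h.powNormSq m x (s.1 x) ≤ S / 4 := by
  obtain ⟨R₁, hR₁, hsub₁⟩ := exists_ball_subset (n := n) (L := L) p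
  have hps := mem_chart_source (Fin n → ℂ) p
  set φ := chartAt (Fin n → ℂ) p with hφ
  have hpe : p ∈ (trivializationAt ℂ L p).baseSet := FiberBundle.mem_baseSet_trivializationAt' p
  set e := trivializationAt ℂ L p with he
  set l : (Fin n → ℂ) → ℝ := fun z => h.localMetric e (φ.symm z) ^ m with hl
  set l₀ := h.localMetric e p ^ m with hl₀
  have hl₀pos : 0 < l₀ := pow_pos (h.localMetric_pos e hpe) m
  have hlc : ContinuousAt l (φ p) := by
    have h1 : ContinuousAt (h.localMetric e) (φ.symm (φ p)) := by
      rw [φ.left_inv hps]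
      exact (h.continuousOn_localMetric e).continuousAt (e.open_baseSet.mem_nhds hpe)
    exact (h1.comp (φ.continuousAt_symm (φ.map_source hps))).pow m
  have hlp : l (φ p) = l₀ := by simp only [hl, φ.left_inv hps, hl₀]
  have hev : ∀ᶠ z in nhds (φ p), l₀ / 2 < l z ∧ l z < 2 * l₀ :=
    (hlc.eventually_const_lt (by rw [hlp]; linarith)).and
      (hlc.eventually_lt_const (by rw [hlp]; linarith))
  obtain ⟨R₂, hR₂, hsub₂⟩ := Metric.eventually_nhds_iff_ball.1 hev
  obtain ⟨R, hR, hRR₁, hRR₂⟩ : ∃ R > 0, R ≤ R₁ ∧ R ≤ R₂ :=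
    ⟨min R₁ R₂, lt_min hR₁ hR₂, min_le_left _ _, min_le_right _ _⟩
  -- On the ball of radius R the metric factor lies between l₀/2 and 2 l₀, so |f|² ≤ 2S/l₀. The
  -- Schwarz lemma at a quarter of the radius divides this by 16, and multiplying back by at most 2
  -- l₀ leaves S/4.
  refine ⟨φ.source ∩ φ ⁻¹' Metric.ball (φ p) (R / 4),
    (φ.isOpen_inter_preimage Metric.isOpen_ball).mem_nhds
      ⟨hps, Metric.mem_ball_self (by positivity)⟩, fun s hsp S hS x hx => ?_⟩
  have hS0 : 0 ≤ S := (h.powNormSq_nonneg m p _).trans (hS p)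
  set f : (Fin n → ℂ) → ℂ := fun z => dualPow m (e.linearMapAt ℂ (φ.symm z)) (s.1 (φ.symm z))
    with hf
  have hfd : DifferentiableOn ℂ f (Metric.ball (φ p) R) :=
    ((contDiffOn_coeff_chart s e p).mono
      ((Metric.ball_subset_ball hRR₁).trans hsub₁)).differentiableOn (by simp)
  have hfp : f (φ p) = 0 := by
    simp only [hf]
    rw [φ.left_inv hps, hsp, map_zero]
  have hval : ∀ z ∈ Metric.ball (φ p) R,
      h.powNormSq m (φ.symm z) (s.1 (φ.symm z)) = ‖f z‖ ^ 2 * l z := fun z hz =>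
    h.powNormSq_eq e (hsub₁ (Metric.ball_subset_ball hRR₁ hz)).2 m _
  have hmaps : Set.MapsTo f (Metric.ball (φ p) R)
      (Metric.closedBall (f (φ p)) (Real.sqrt (2 * S / l₀))) := by
    intro z hz
    rw [hfp, mem_closedBall_zero_iff]
    refine Real.le_sqrt_of_sq_le ?_
    rw [le_div_iff₀ hl₀pos]
    have h1 := hS (φ.symm z)
    rw [hval z hz] at h1
    have h2 := (hsub₂ z (Metric.ball_subset_ball hRR₂ hz)).1
    nlinarith [sq_nonneg ‖f z‖]
  have hxR : φ x ∈ Metric.ball (φ p) R := Metric.ball_subset_ball (by linarith) hx.2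
  have hschwarz := Complex.dist_le_div_mul_dist_of_mapsTo_ball hfd hmaps hxR
  rw [hfp, dist_zero_right] at hschwarz
  have hfx : ‖f (φ x)‖ ≤ Real.sqrt (2 * S / l₀) / 4 := by
    refine hschwarz.trans ?_
    rw [div_mul_eq_mul_div, div_le_iff₀ hR]
    have h3 : dist (φ x) (φ p) ≤ R / 4 := (Metric.mem_ball.1 hx.2).le
    calc _ ≤ Real.sqrt (2 * S / l₀) * (R / 4) := by gcongr
      _ = _ := by ring
  have hfx2 : ‖f (φ x)‖ ^ 2 ≤ (2 * S / l₀) / 16 := by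
    calc _ ≤ (Real.sqrt (2 * S / l₀) / 4) ^ 2 := by gcongr
      _ = _ := by rw [div_pow, Real.sq_sqrt (by positivity)]; norm_num
  have h4 := hval _ hxR
  rw [φ.left_inv hx.1] at h4
  rw [h4]
  have h5 := (hsub₂ _ (Metric.ball_subset_ball hRR₂ hxR)).2
  have h6 := (hsub₂ _ (Metric.ball_subset_ball hRR₂ hxR)).1
  calc _ ≤ (2 * S / l₀) / 16 * (2 * l₀) := by gcongr; linarith
    _ = S / 4 := by field_simp; ring

/-- The space of holomorphic sections of `L^m` over a compact manifold is finite-dimensional. -/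
theorem finiteDimensional_holSections [CompactSpace M] [Nonempty M] (h : HermitianMetric n L)
    (m : ℕ) : FiniteDimensional ℂ (holSections n L m) := by
  choose V hV hVs using exists_nhds_powNormSq_le h m
  obtain ⟨t, ht⟩ := isCompact_univ.elim_nhds_subcover V fun p _ => hV p
  -- Evaluation at the finitely many centres of the cover is injective: for a section in its kernel,
  -- the maximum of the squared norm is at most a quarter of itself.
  let ev : holSections n L m →ₗ[ℂ] (t → ℂ) := LinearMap.pi fun p =>
    (dualPow m ((trivializationAt ℂ L p.1).linearMapAt ℂ p.1)) ∘ₗ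
      (LinearMap.proj p.1) ∘ₗ (holSections n L m).subtype
  refine FiniteDimensional.of_injective ev ((injective_iff_map_eq_zero ev).2 fun s hs => ?_)
  have hsp : ∀ p ∈ t, s.1 p = 0 := fun p hp =>
    eq_zero_of_dualPow_linearMapAt _ (FiberBundle.mem_baseSet_trivializationAt' p)
      (congrFun hs ⟨p, hp⟩)
  obtain ⟨x, -, hx⟩ := isCompact_univ.exists_isMaxOn Set.univ_nonempty
    (continuous_powNormSq h s).continuousOn
  have hmax : ∀ y, h.powNormSq m y (s.1 y) ≤ h.powNormSq m x (s.1 x) := fun y => hx (Set.mem_univ y)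
  obtain ⟨p, hpt, hxp⟩ := Set.mem_iUnion₂.1 (ht.2 (Set.mem_univ x))
  have h1 := hVs p s (hsp p hpt) _ hmax x hxp
  refine Subtype.ext (funext fun y => h.eq_zero_of_powNormSq ?_)
  linarith [hmax y, h.powNormSq_nonneg m y (s.1 y)]

end HolSections

end LineBundle

/-! ### The Hilbert space of sections of L^m -/

section Symbol

variable {n : ℕ} {M : Type*} [TopologicalSpace M] [ChartedSpace (Fin n → ℂ) M]
  {L : M → Type*} [∀ x, AddCommGroup (L x)] [∀ x, Module ℂ (L x)] [∀ x, TopologicalSpace (L x)]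
  [TopologicalSpace (TotalSpace ℂ L)] [FiberBundle ℂ L] [VectorBundle ℂ ℂ L] {m : ℕ}

/-- The `m`-th tensor power of a holomorphic section of `L`. -/
noncomputable def powSection [ContMDiffVectorBundle ω ℂ L 𝓘(ℂ, Fin n → ℂ)] (m : ℕ)
    (s : Cₛ^ω⟮𝓘(ℂ, Fin n → ℂ); ℂ, L⟯) : holSections n L m :=
  ⟨fun x => PiTensorProduct.tprod ℂ fun _ => s x, by
    intro e _
    have h1 := e.contMDiffOn_section_baseSet_iff.1 (s.contMDiff.contMDiffOn (s := e.baseSet))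
    refine (h1.pow m).congr fun x hx => ?_
    simp [dualPow_tprod, e.coe_linearMapAt_of_mem hx]⟩

theorem IsVeryAmple.exists_dualPow_ne_zero [ContMDiffVectorBundle ω ℂ L 𝓘(ℂ, Fin n → ℂ)]
    (hL : IsVeryAmple n L) (m : ℕ) {x : M} {α : L x →ₗ[ℂ] ℂ} (hα : α ≠ 0) :
    ∃ s : holSections n L m, dualPow m α (s.1 x) ≠ 0 := by
  obtain ⟨s, hs⟩ := hL.wellDefined x α hα
  refine ⟨powSection m s, ?_⟩
  change dualPow m α (PiTensorProduct.tprod ℂ fun _ => s x) ≠ 0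
  rw [dualPow_tprod]
  simp [hs]

theorem dualPow_sum_smul {ι : Type*} [Fintype ι] (x : M) (α : L x →ₗ[ℂ] ℂ) (c : ι → ℂ)
    (t : ι → holSections n L m) :
    dualPow m α ((∑ i, c i • t i : holSections n L m).1 x)
      = ∑ i, c i * dualPow m α ((t i).1 x) := by
  let ev : holSections n L m →ₗ[ℂ] ℂ :=
    dualPow m α ∘ₗ LinearMap.proj x ∘ₗ (holSections n L m).subtype
  change ev _ = ∑ i, c i * ev (t i)
  simp only [map_sum, map_smul, smul_eq_mul]

variable [T2Space M] [CompactSpace M] [MeasurableSpace M] [BorelSpace M]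
  (κ : KahlerForm n M) (h : HermitianMetric n L)

theorem integrable_powInner (s t : holSections n L m) :
    Integrable (fun x => h.powInner m x (s.1 x) (t.1 x)) κ.liouville :=
  (continuous_powInner h s t).integrable_of_hasCompactSupport (HasCompactSupport.of_compactSpace _)

variable (m) in
/-- The scalar product of holomorphic sections of `L^m` as a sesquilinear form. -/
noncomputable def scalarForm : holSections n L m →ₗ⋆[ℂ] holSections n L m →ₗ[ℂ] ℂ :=
  LinearMap.mk₂'ₛₗ (starRingEnd ℂ) (RingHom.id ℂ) (fun s t => scalarProduct κ h m s.1 t.1)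
    (fun s s' t => by
      rw [scalarProduct, scalarProduct, scalarProduct,
        ← integral_add (integrable_powInner κ h s t) (integrable_powInner κ h s' t)]
      refine integral_congr_ae (Filter.Eventually.of_forall fun x => ?_)
      simp only [Submodule.coe_add, Pi.add_apply, HermitianMetric.powInner, map_add, star_add]
      ring)
    (fun c s t => by
      rw [scalarProduct, scalarProduct, smul_eq_mul, ← integral_const_mul]
      refine integral_congr_ae (Filter.Eventually.of_forall fun x => ?_)
      simp only [Submodule.coe_smul, Pi.smul_apply, HermitianMetric.powInner, map_smul, smul_eq_mul,
        star_mul', starRingEnd_apply]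
      ring)
    (fun s t t' => by
      rw [scalarProduct, scalarProduct, scalarProduct,
        ← integral_add (integrable_powInner κ h s t) (integrable_powInner κ h s t')]
      refine integral_congr_ae (Filter.Eventually.of_forall fun x => ?_)
      simp only [Submodule.coe_add, Pi.add_apply, HermitianMetric.powInner, map_add]
      ring)
    (fun c s t => by
      rw [scalarProduct, scalarProduct, RingHom.id_apply, smul_eq_mul, ← integral_const_mul]
      refine integral_congr_ae (Filter.Eventually.of_forall fun x => ?_)
      simp only [Submodule.coe_smul, Pi.smul_apply, HermitianMetric.powInner, map_smul, smul_eq_mul]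
      ring)

theorem scalarForm_apply (s t : holSections n L m) :
    scalarForm m κ h s t = scalarProduct κ h m s.1 t.1 := rfl

theorem scalarForm_self (s : holSections n L m) :
    scalarForm m κ h s s = ((∫ x, h.powNormSq m x (s.1 x) ∂κ.liouville : ℝ) : ℂ) := by
  rw [scalarForm_apply, scalarProduct]
  simp only [h.powInner_self]
  exact integral_ofReal

theorem conj_scalarForm (s t : holSections n L m) :
    star (scalarForm m κ h s t) = scalarForm m κ h t s := by
  rw [scalarForm_apply, scalarForm_apply, scalarProduct, scalarProduct, Complex.star_def,
    ← integral_conj]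
  exact integral_congr_ae (Filter.Eventually.of_forall fun x => h.star_powInner m x _ _)

variable [IsManifold 𝓘(ℂ, Fin n → ℂ) ω M]

/-- The squared norm is continuous and nonnegative, and the measure has full support, so a vanishing
integral forces it to vanish at every point. -/
theorem eq_zero_of_scalarForm_self {s : holSections n L m} (h0 : scalarForm m κ h s s = 0) :
    s = 0 := by
  have hnn : ∀ x, 0 ≤ h.powNormSq m x (s.1 x) := fun x => h.powNormSq_nonneg m x _
  have hc := continuous_powNormSq h s
  rw [scalarForm_self, Complex.ofReal_eq_zero, integral_eq_zero_iff_of_nonneg hnn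
    (hc.integrable_of_hasCompactSupport (HasCompactSupport.of_compactSpace _)),
    hc.ae_eq_iff_eq _ continuous_zero] at h0
  exact Subtype.ext (funext fun x => h.eq_zero_of_powNormSq (congrFun h0 x))

variable (m) in
/-- The scalar product makes the space of holomorphic sections of `L^m` an inner product space. -/
@[reducible]
noncomputable def scalarCore : InnerProductSpace.Core ℂ (holSections n L m) where
  inner s t := scalarForm m κ h s t
  conj_inner_symm s t := conj_scalarForm κ h t s
  re_inner_nonneg s := by
    rw [scalarForm_self]
    exact integral_nonneg fun x => h.powNormSq_nonneg m x _
  add_left s t u := by rw [map_add, LinearMap.add_apply]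
  smul_left s t c := by rw [LinearMap.map_smulₛₗ, LinearMap.smul_apply, smul_eq_mul]
  definite s hs := eq_zero_of_scalarForm_self κ h hs

variable (m) in
theorem exists_orthonormal_holSections [Nonempty M] :
    ∃ (N : ℕ) (b : Module.Basis (Fin N) ℂ (holSections n L m)),
      ∀ i j, scalarForm m κ h (b i) (b j) = if i = j then 1 else 0 := by
  have := finiteDimensional_holSections h m
  exact exists_orthonormal_basis (scalarCore m κ h)

/-! ### Coherent vectors and symbols in an orthonormal basis -/

section Basis

variable {κ h} {N : ℕ} {b : Module.Basis (Fin N) ℂ (holSections n L m)}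
  (hb : ∀ i j, scalarForm m κ h (b i) (b j) = if i = j then 1 else 0) (x : M) (α : L x →ₗ[ℂ] ℂ)

include hb

omit [IsManifold 𝓘(ℂ, Fin n → ℂ) ω M] in
theorem isCoherentVector_sum :
    IsCoherentVector κ h m x α (∑ i, star (dualPow m α ((b i).1 x)) • b i) := by
  intro s
  rw [← scalarForm_apply]
  have hval : dualPow m α (s.1 x) = ∑ i, b.repr s i * dualPow m α ((b i).1 x) := by
    rw [← dualPow_sum_smul, b.sum_repr]
  rw [hval]
  conv_lhs => rw [← b.sum_repr s]
  simp only [map_sum, LinearMap.sum_apply, LinearMap.map_smulₛₗ, LinearMap.smul_apply, hb,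
    smul_eq_mul, mul_ite, mul_one, mul_zero, Finset.sum_ite_eq', Finset.mem_univ,
    if_true, RingHom.id_apply, starRingEnd_apply, star_star]

theorem existsUnique_isCoherentVector : ∃! e : holSections n L m, IsCoherentVector κ h m x α e := by
  refine ⟨_, isCoherentVector_sum hb x α, fun e he => ?_⟩
  have h1 : ∀ s, scalarForm m κ h (e - ∑ i, star (dualPow m α ((b i).1 x)) • b i) s = 0 := by
    intro s
    rw [map_sub, LinearMap.sub_apply, scalarForm_apply, scalarForm_apply, he,
      isCoherentVector_sum hb x α, sub_self]
  exact sub_eq_zero.1 (eq_zero_of_scalarForm_self κ h (h1 _))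

/-- The default value 0 in the definition never occurs, since a coherent vector exists; uniqueness
identifies the chosen one with the explicit sum. -/
theorem coherentVector_eq_sum :
    coherentVector κ h m x α = ∑ i, star (dualPow m α ((b i).1 x)) • b i := by
  have hex := existsUnique_isCoherentVector hb x α
  rw [coherentVector, dif_pos hex.exists]
  exact hex.unique hex.exists.choose_spec (isCoherentVector_sum hb x α)

theorem scalarProduct_coherentVector (A : Module.End ℂ (holSections n L m)) :
    scalarProduct κ h m (coherentVector κ h m x α).1 (A (coherentVector κ h m x α)).1
      = ∑ i, star (dualPow m α ((b i).1 x)) * dualPow m α ((A (b i)).1 x) := by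
  have := isCoherentVector_sum hb x α (A (coherentVector κ h m x α))
  rw [← coherentVector_eq_sum hb] at this
  rw [this, coherentVector_eq_sum hb, map_sum]
  simp only [map_smul, dualPow_sum_smul]

theorem scalarProduct_coherentVector_self :
    scalarProduct κ h m (coherentVector κ h m x α).1 (coherentVector κ h m x α).1
      = ∑ i, star (dualPow m α ((b i).1 x)) * dualPow m α ((b i).1 x) := by
  simpa using scalarProduct_coherentVector hb x α LinearMap.id

theorem symbolAt_eq (A : Module.End ℂ (holSections n L m)) :
    symbolAt κ h m A x α = (∑ i, star (dualPow m α ((b i).1 x)) * dualPow m α ((A (b i)).1 x))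
      / ∑ i, star (dualPow m α ((b i).1 x)) * dualPow m α ((b i).1 x) := by
  rw [symbolAt, scalarProduct_coherentVector hb, scalarProduct_coherentVector_self hb]

/-- Numerator and denominator both scale by |c|^{2m}. -/
theorem symbolAt_smul (A : Module.End ℂ (holSections n L m)) {c : ℂ} (hc : c ≠ 0) :
    symbolAt κ h m A x (c • α) = symbolAt κ h m A x α := by
  have key : ∀ t : Fin N → holSections n L m,
      ∑ i, star (dualPow m (c • α) ((b i).1 x)) * dualPow m (c • α) ((t i).1 x)
        = star (c ^ m) * c ^ m * ∑ i, star (dualPow m α ((b i).1 x)) * dualPow m α ((t i).1 x) := by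
    intro t
    rw [Finset.mul_sum]
    refine Finset.sum_congr rfl fun i _ => ?_
    rw [dualPow_smul, dualPow_smul, star_mul']
    ring
  rw [symbolAt_eq hb, symbolAt_eq hb, key, key b, mul_div_mul_left]
  simp [hc]

theorem symbolAt_eq_of_ne_zero (A : Module.End ℂ (holSections n L m)) {β : L x →ₗ[ℂ] ℂ} (hα : α ≠ 0)
    (hβ : β ≠ 0) : symbolAt κ h m A x α = symbolAt κ h m A x β := by
  have hx : x ∈ (trivializationAt ℂ L x).baseSet := FiberBundle.mem_baseSet_trivializationAt' x
  have key : ∀ γ : L x →ₗ[ℂ] ℂ, γ ≠ 0 → symbolAt κ h m A x γ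
      = symbolAt κ h m A x ((trivializationAt ℂ L x).linearMapAt ℂ x) := by
    intro γ hγ
    have h1 := eq_smul_linearMapAt _ hx γ
    rw [h1, symbolAt_smul hb]
    intro h0
    exact hγ (by rw [h1, h0, zero_smul])
  rw [key α hα, key β hβ]

/-- The sum is the squared norm of e_α. If it were zero, e_α would vanish, and by the reproducing
property so would α^{⊗m}(s(x)) for every s, against the absence of base points. -/
theorem sum_star_mul_self_ne_zero [ContMDiffVectorBundle ω ℂ L 𝓘(ℂ, Fin n → ℂ)]
    (hL : IsVeryAmple n L) (hα : α ≠ 0) :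
    ∑ i, star (dualPow m α ((b i).1 x)) * dualPow m α ((b i).1 x) ≠ 0 := by
  rw [← scalarProduct_coherentVector_self hb, ← scalarForm_apply]
  intro h0
  obtain ⟨s, hs⟩ := hL.exists_dualPow_ne_zero m hα
  refine hs ?_
  rw [← isCoherentVector_sum hb x α s, ← coherentVector_eq_sum hb, ← scalarForm_apply,
    eq_zero_of_scalarForm_self κ h h0, map_zero, LinearMap.zero_apply]

omit α

theorem covariantSymbol_eq (e : Trivialization ℂ (TotalSpace.proj : TotalSpace ℂ L → M))
    [MemTrivializationAtlas e] (hx : x ∈ e.baseSet) (A : Module.End ℂ (holSections n L m)) :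
    covariantSymbol κ h m A x =
      (∑ i, star (dualPow m (e.linearMapAt ℂ x) ((b i).1 x))
          * dualPow m (e.linearMapAt ℂ x) ((A (b i)).1 x))
        / ∑ i, star (dualPow m (e.linearMapAt ℂ x) ((b i).1 x))
          * dualPow m (e.linearMapAt ℂ x) ((b i).1 x) := by
  rw [← symbolAt_eq hb]
  exact symbolAt_eq_of_ne_zero hb x _ A
    (linearMapAt_ne_zero _ (FiberBundle.mem_baseSet_trivializationAt' x)) (linearMapAt_ne_zero e hx)

omit x

theorem contMDiff_covariantSymbol [ContMDiffVectorBundle ω ℂ L 𝓘(ℂ, Fin n → ℂ)]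
    (hL : IsVeryAmple n L) (A : Module.End ℂ (holSections n L m)) :
    ContMDiff 𝓘(ℝ, Fin n → ℂ) 𝓘(ℝ, ℂ) ∞ (covariantSymbol κ h m A) := by
  intro p
  obtain ⟨R, hR, hsub⟩ := exists_ball_subset (n := n) (L := L) p
  have hps := mem_chart_source (Fin n → ℂ) p
  set φ := chartAt (Fin n → ℂ) p with hφ
  set e := trivializationAt ℂ L p with he
  have hcoef : ∀ s : holSections n L m, ContDiffOn ℝ ∞
      (fun z => dualPow m (e.linearMapAt ℂ (φ.symm z)) (s.1 (φ.symm z)))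
      (Metric.ball (φ p) R) := fun s =>
    (((contDiffOn_coeff_chart s e p).mono hsub).restrict_scalars ℝ).of_le
      le_top
  have hstar : ∀ s : holSections n L m, ContDiffOn ℝ ∞
      (fun z => star (dualPow m (e.linearMapAt ℂ (φ.symm z)) (s.1 (φ.symm z))))
      (Metric.ball (φ p) R) := fun s => Complex.conjCLE.contDiff.comp_contDiffOn (hcoef s)
  have hd : ContDiffOn ℝ ∞ (covariantSymbol κ h m A ∘ φ.symm) (Metric.ball (φ p) R) := by
    refine ((ContDiffOn.sum fun i _ => (hstar (b i)).mul (hcoef (A (b i)))).mul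
      (ContDiffOn.inv (ContDiffOn.sum fun i _ => (hstar (b i)).mul (hcoef (b i)))
        fun z hz => ?_)).congr fun z hz =>
          (covariantSymbol_eq hb (φ.symm z) e (hsub hz).2 A).trans (div_eq_mul_inv _ _)
    exact sum_star_mul_self_ne_zero hb (φ.symm z) _ hL (linearMapAt_ne_zero e (hsub hz).2)
  have hda := hd.contDiffAt (Metric.isOpen_ball.mem_nhds (Metric.mem_ball_self hR))
  have hcont : ContinuousAt (covariantSymbol κ h m A) p := by
    have h1 : ContinuousAt ((covariantSymbol κ h m A ∘ φ.symm) ∘ φ) p :=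
      hda.continuousAt.comp (φ.continuousAt hps)
    refine h1.congr ?_
    filter_upwards [φ.open_source.mem_nhds hps] with y hy
    simp [φ.left_inv hy]
  rw [contMDiffAt_iff]
  refine ⟨hcont, ?_⟩
  simpa [chartAt_self_eq, ← hφ] using hda.contDiffWithinAt

theorem injective_covariantSymbol [ContMDiffVectorBundle ω ℂ L 𝓘(ℂ, Fin n → ℂ)] [ConnectedSpace M]
    (hL : IsVeryAmple n L) : Function.Injective (covariantSymbol κ h m) := by
  intro A A' hAA'
  obtain ⟨p⟩ := (inferInstance : Nonempty M)
  obtain ⟨R, hR, hsub⟩ := exists_ball_subset (n := n) (L := L) p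
  have hps := mem_chart_source (Fin n → ℂ) p
  set φ := chartAt (Fin n → ℂ) p with hφ
  set e := trivializationAt ℂ L p with he
  have hcoef : ∀ s : holSections n L m, DifferentiableOn ℂ
      (fun z => dualPow m (e.linearMapAt ℂ (φ.symm z)) (s.1 (φ.symm z)))
      (Metric.ball (φ p) R) := fun s =>
    ((contDiffOn_coeff_chart s e p).mono hsub).differentiableOn (by simp)
  set U := φ.source ∩ φ ⁻¹' Metric.ball (φ p) R with hU
  have hUo : IsOpen U := φ.isOpen_inter_preimage Metric.isOpen_ball
  have hUne : U.Nonempty := ⟨p, hps, Metric.mem_ball_self hR⟩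
  have hUb : ∀ x ∈ U, x ∈ e.baseSet := fun x hx => by
    have : φ.symm (φ x) ∈ e.baseSet := (hsub hx.2).2
    rwa [φ.left_inv hx.1] at this
  set C := A - A' with hC
  have hdiag : ∀ z ∈ Metric.ball (φ p) R,
      ∑ i, star (dualPow m (e.linearMapAt ℂ (φ.symm z)) ((b i).1 (φ.symm z)))
        * dualPow m (e.linearMapAt ℂ (φ.symm z)) ((C (b i)).1 (φ.symm z)) = 0 := by
    intro z hz
    have h1 := congrFun hAA' (φ.symm z)
    -- Both symbols have the same nonzero denominator, so their numerators agree.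
    rw [covariantSymbol_eq hb _ e (hsub hz).2, covariantSymbol_eq hb _ e (hsub hz).2,
      div_left_inj' (sum_star_mul_self_ne_zero hb _ _ hL (linearMapAt_ne_zero e (hsub hz).2)),
      ← sub_eq_zero, ← Finset.sum_sub_distrib] at h1
    rw [← h1]
    refine Finset.sum_congr rfl fun i _ => ?_
    rw [← mul_sub, ← map_sub]
    rfl
  have hpol : ∀ y ∈ U, ∀ x ∈ U,
      ∑ i, star (dualPow m (e.linearMapAt ℂ y) ((b i).1 y))
        * dualPow m (e.linearMapAt ℂ x) ((C (b i)).1 x) = 0 := by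
    intro y hy x hx
    have := sum_star_mul_eq_zero_of_diagonal Metric.isOpen_ball (convex_ball (φ p) R)
      (fun i => hcoef (b i)) (fun i => hcoef (C (b i))) hdiag hx.2 hy.2
    rwa [φ.left_inv hx.1, φ.left_inv hy.1] at this
  -- For fixed y, the polarized kernel as a function of x is the coefficient of the section C e_y;
  -- vanishing on U makes it zero on M.
  have hker : ∀ y ∈ U, C (coherentVector κ h m y (e.linearMapAt ℂ y)) = 0 := by
    intro y hy
    refine eq_zero_of_eqOn_isOpen _ hUo hUne fun x hx =>
      eq_zero_of_dualPow_linearMapAt e (hUb x hx) ?_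
    rw [← hpol y hy x hx, coherentVector_eq_sum hb, map_sum]
    simp only [map_smul, dualPow_sum_smul]
  -- Now y varies. The conjugate of the k-th coordinate of C e_y is the coefficient at y of the
  -- holomorphic section on the left, which is thus zero on U and so on M. Linear independence of
  -- the b_i then kills every matrix entry of C.
  have hzero : ∀ k, ∑ i, star (b.repr (C (b i)) k) • b i = 0 := by
    intro k
    refine eq_zero_of_eqOn_isOpen _ hUo hUne fun y hy =>
      eq_zero_of_dualPow_linearMapAt e (hUb y hy) ?_
    have h1 := congrArg (fun t => star (b.repr t k)) (hker y hy)
    rw [coherentVector_eq_sum hb, map_sum] at h1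
    rw [dualPow_sum_smul]
    simpa [mul_comm] using h1
  refine sub_eq_zero.1 (b.ext fun i => b.repr.injective (Finsupp.ext fun k => ?_))
  have h1 : b.repr (C (b i)) k = 0 :=
    star_eq_zero.1 (Fintype.linearIndependent_iff.1 b.linearIndependent _ (hzero k) i)
  simpa [hC] using h1

end Basis

end Symbol

end BerezinToeplitz

theorem proposition5p7
    {n : ℕ} {M : Type*} [TopologicalSpace M] [ChartedSpace (Fin n → ℂ) M]
    [IsManifold 𝓘(ℂ, Fin n → ℂ) ω M]
    [T2Space M] [CompactSpace M] [ConnectedSpace M] [MeasurableSpace M] [BorelSpace M]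
    {L : M → Type*} [∀ x, AddCommGroup (L x)] [∀ x, Module ℂ (L x)]
    [∀ x, TopologicalSpace (L x)] [TopologicalSpace (TotalSpace ℂ L)]
    [FiberBundle ℂ L] [VectorBundle ℂ ℂ L]
    [ContMDiffVectorBundle ω ℂ L 𝓘(ℂ, Fin n → ℂ)]
    (κ : BerezinToeplitz.KahlerForm n M) (h : BerezinToeplitz.HermitianMetric n L)
    (hquantum : h.IsQuantum κ) (hample : BerezinToeplitz.IsVeryAmple n L) (m : ℕ) :
    -- coherent vectors exist, are unique, and are nonzero
    (∀ (x : M) (α : L x →ₗ[ℂ] ℂ), α ≠ 0 →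
      (∃! e : BerezinToeplitz.holSections n L m, BerezinToeplitz.IsCoherentVector κ h m x α e) ∧
      BerezinToeplitz.scalarProduct κ h m (BerezinToeplitz.coherentVector κ h m x α).1
        (BerezinToeplitz.coherentVector κ h m x α).1 ≠ 0) ∧
    -- the symbol does not depend on the choice of the point `α` over `x`
    (∀ (A : Module.End ℂ (BerezinToeplitz.holSections n L m)) (x : M) (α : L x →ₗ[ℂ] ℂ), α ≠ 0 →
      BerezinToeplitz.covariantSymbol κ h m A x = BerezinToeplitz.symbolAt κ h m A x α) ∧
    -- the symbol of an operator is a smooth function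
    (∀ A : Module.End ℂ (BerezinToeplitz.holSections n L m),
      ContMDiff 𝓘(ℝ, Fin n → ℂ) 𝓘(ℝ, ℂ) ∞ (BerezinToeplitz.covariantSymbol κ h m A)) ∧
    -- the symbol map is injective
    Function.Injective (fun A : Module.End ℂ (BerezinToeplitz.holSections n L m) =>
      BerezinToeplitz.covariantSymbol κ h m A) := by
  obtain ⟨N, b, hb⟩ := BerezinToeplitz.exists_orthonormal_holSections m κ h
  refine ⟨fun x α hα => ⟨BerezinToeplitz.existsUnique_isCoherentVector hb x α, ?_⟩,
    fun A x α hα => ?_, BerezinToeplitz.contMDiff_covariantSymbol hb hample,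
    BerezinToeplitz.injective_covariantSymbol hb hample⟩
  · rw [BerezinToeplitz.scalarProduct_coherentVector_self hb]
    exact BerezinToeplitz.sum_star_mul_self_ne_zero hb x α hample hα
  · exact BerezinToeplitz.symbolAt_eq_of_ne_zero hb x _ A
      (BerezinToeplitz.linearMapAt_ne_zero _ (FiberBundle.mem_baseSet_trivializationAt' x)) hα
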